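/- Let $n,m\ge 0$ be integers with $d=n+m\ge 1$, let $0\le\alpha<2$ and $\beta_1,\dots,\beta_m\ge 0$; if $n=0$, assume moreover that $\beta_1=\dots=\beta_m=0$. Write points of $\mathbb{R}^d=\mathbb{R}^n\times\mathbb{R}^m$ as $(x,y)$ with $x=(x_1,\dots,x_n)$ and $y=(y_1,\dots,y_m)$, put $|x|_n=\bigl(\sum_{i=1}^n x_i^2\bigr)^{1/2}$, and let $A$ be the generalized Grušin matrix, i.e. the diagonal $d\times d$ matrix function $$A(x,y)=\operatorname{diag}\bigl(\underbrace{|x|_n^{\alpha},\dots,|x|_n^{\alpha}}_{n\text{ times}},\,|x|_n^{\beta_1},\dots,|x|_n^{\beta_m}\bigr),$$ with the convention $0^0=1$. For a $C^1$ function $f$ on $\mathbb{R}^d$ let $\nabla_A f=A\nabla f$, with length $$|\nabla_A f|_A=\sqrt{\langle\nabla f,A\nabla f\rangle}=\Bigl(|x|_n^{\alpha}\sum_{i=1}^n\Bigl|\frac{\partial f}{\partial x_i}\Bigr|^2+\sum_{j=1}^m|x|_n^{\beta_j}\Bigl|\frac{\partial f}{\partial y_j}\Bigr|^2\Bigr)^{1/2}.$$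 Let $$D=\Bigl(n+m\bigl(1-\tfrac{\alpha}{2}\bigr)+\tfrac12\sum_{k=1}^m\beta_k\Bigr)\bigl(1-\tfrac{\alpha}{2}\bigr)^{-1}.$$ Then there is a constant $C>0$, depending only on $n,m,\alpha,\beta_1,\dots,\beta_m$, such that the Nash inequality $$\|f\|_2\le C\,\bigl\||\nabla_A f|_A\bigr\|_2^{\frac{D}{D+2}}\,\|f\|_1^{1-\frac{D}{D+2}}$$ holds for every $f\in C_c^1(\mathbb{R}^d)$ (real- or complex-valued), where $\|\cdot\|_p$ is the norm of $L^p(\mathbb{R}^d)$ with respect to Lebesgue measure. -/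

import Mathlib

open MeasureTheory
open scoped ENNReal NNReal

noncomputable section

namespace Grushin

/-- The coordinate space `ℝ^d`, `d = n + m`, with its Euclidean structure and Lebesgue measure.
The first block of coordinates is `x_1, …, x_n`, the second block is `y_1, …, y_m`. -/
abbrev Space (n m : ℕ) : Type := EuclideanSpace ℝ (Fin n ⊕ Fin m)

/-- The Euclidean length `|z|_n` of the first `n` coordinates of `z`. -/
def firstNorm {n m : ℕ} (z : Space n m) : ℝ :=
  Real.sqrt (∑ i : Fin n, z (Sum.inl i) ^ 2)

/-- The generalized Grušin matrix at the point `z`: the diagonal matrix with `n` entries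
`|z|_n ^ α` followed by the entries `|z|_n ^ β_1, …, |z|_n ^ β_m`. -/
def grushinMatrix {n m : ℕ} (α : ℝ) (β : Fin m → ℝ) (z : Space n m) :
    Matrix (Fin n ⊕ Fin m) (Fin n ⊕ Fin m) ℝ :=
  Matrix.fromBlocks
    ((firstNorm z ^ α) • (1 : Matrix (Fin n) (Fin n) ℝ)) 0
    0 (Matrix.diagonal fun j => firstNorm z ^ β j)

/-- The Euclidean gradient: the vector of all first partial derivatives of `f` at `z`. -/
def euclGrad {𝕜 : Type*} [RCLike 𝕜] {n m : ℕ} (f : Space n m → 𝕜) (z : Space n m) :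
    Fin n ⊕ Fin m → 𝕜 :=
  fun k => fderiv ℝ f z (EuclideanSpace.single k 1)

/-- The gradient `∇_A f = A ∇f` associated with a matrix field `A`. -/
def matGrad {𝕜 : Type*} [RCLike 𝕜] {n m : ℕ}
    (A : Space n m → Matrix (Fin n ⊕ Fin m) (Fin n ⊕ Fin m) ℝ)
    (f : Space n m → 𝕜) (z : Space n m) : Fin n ⊕ Fin m → 𝕜 :=
  Matrix.mulVec ((A z).map (algebraMap ℝ 𝕜)) (euclGrad f z)

/-- The length `|∇_A f|_A = √⟨∇f, A ∇f⟩` of the gradient associated with a field `A` of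
symmetric positive semidefinite matrices. Where `A` is invertible this is
`√⟨A⁻¹ (∇_A f), ∇_A f⟩`; the formula needs no inverse, so it is used where `A` degenerates too. -/
def gradLength {𝕜 : Type*} [RCLike 𝕜] {n m : ℕ}
    (A : Space n m → Matrix (Fin n ⊕ Fin m) (Fin n ⊕ Fin m) ℝ)
    (f : Space n m → 𝕜) (z : Space n m) : ℝ :=
  Real.sqrt (RCLike.re (star (euclGrad f z) ⬝ᵥ matGrad A f z))

/-- The homogeneous dimension
`D = (n + m (1 - α/2) + (1/2) ∑ β_k) (1 - α/2)⁻¹`. -/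
def homDim (n m : ℕ) (α : ℝ) (β : Fin m → ℝ) : ℝ :=
  ((n : ℝ) + (m : ℝ) * (1 - α / 2) + 1 / 2 * ∑ k : Fin m, β k) * (1 - α / 2)⁻¹

end Grushin

end

noncomputable section

/-! Write F for the squared L² norm, E for the energy ∫⟨∇f, A∇f⟩ and N for the L¹ norm.

Dilations reduce the claim to unit scale. Anisotropic dilations multiply E by t and have Jacobian
t^(D/2), so F ≤ C(E + N²) for all f becomes F ≤ C(tE + t^(-D/2) N²) for all t > 0
(`exists_scale_bound_real`). The choice of t that balances the two terms gives the Nash exponents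
(`le_rpow_mul_rpow_of_forall_scale`).

At unit scale (`exists_unit_scale_bound`) with n ≥ 1, take a cutoff χ(x) that vanishes for |x| ≤ 1
and equals 1 for |x|² ≥ 2. Where χ lives, A dominates the identity, so the Euclidean inequality
(`integral_sq_le_fderiv_add`) applies to χf. The remaining mass is handled by a Hardy inequality
(`integral_sq_le_cutoff`): integrate the divergence of (1 - χ²) x_i f² e_i, using x_i² ≤ 2|x|^α on
|x|² ≤ 2, which is where α < 2 enters. The cross terms are absorbed by taking the Euclidean scale r
small. If n = 0, A is the identity. -/

lemma HasCompactSupport.sq_comp {X : Type*} [TopologicalSpace X] {f : X → ℝ}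
    (hf : HasCompactSupport f) : HasCompactSupport fun x => f x ^ 2 :=
  hf.comp_left (g := fun t : ℝ => t ^ 2) (by simp)

namespace Grushin

/-! ### Euclidean Nash inequality by averaging over translates -/

section Euclidean

variable {V : Type*} [NormedAddCommGroup V] [NormedSpace ℝ V] [FiniteDimensional ℝ V]
  [MeasurableSpace V] [BorelSpace V] {μ : Measure V} [μ.IsAddHaarMeasure]

lemma sq_integral_unitInterval_le {g : ℝ → ℝ} (hg : Continuous g) :
    (∫ s in (0 : ℝ)..1, g s) ^ 2 ≤ ∫ s in (0 : ℝ)..1, g s ^ 2 := by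
  set c := ∫ s in (0 : ℝ)..1, g s with hc
  -- The variance of `g` is nonnegative.
  have h0 : 0 ≤ ∫ s in (0 : ℝ)..1, (g s - c) ^ 2 :=
    intervalIntegral.integral_nonneg zero_le_one fun s _ => sq_nonneg _
  have h1 : ∫ s in (0 : ℝ)..1, (g s - c) ^ 2
      = (∫ s in (0 : ℝ)..1, g s ^ 2) - 2 * c * c + c ^ 2 := by
    have : ∀ s, (g s - c) ^ 2 = g s ^ 2 - 2 * c * g s + c ^ 2 := fun s => by ring
    simp_rw [this]
    rw [intervalIntegral.integral_add, intervalIntegral.integral_sub,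
      intervalIntegral.integral_const_mul, ← hc]
    · simp
    all_goals exact Continuous.intervalIntegrable (by fun_prop) _ _
  nlinarith

omit [FiniteDimensional ℝ V] [MeasurableSpace V] [BorelSpace V] in
/-- The pointwise estimate behind the `L²` bound for translates. -/
lemma sq_sub_translate_le {f : V → ℝ} (hf : ContDiff ℝ 1 f) (h z : V) :
    (f (z + h) - f z) ^ 2 ≤ ∫ s in (0 : ℝ)..1, (fderiv ℝ f (z + s • h) h) ^ 2 := by
  have hcont : Continuous (fderiv ℝ f) := hf.continuous_fderiv one_ne_zero
  have hder : ∀ s ∈ Set.uIcc (0 : ℝ) 1,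
      HasDerivAt (fun s : ℝ => f (z + s • h)) (fderiv ℝ f (z + s • h) h) s := by
    intro s _
    have h1 : HasDerivAt (fun s : ℝ => z + s • h) h s := by
      simpa using ((hasDerivAt_id s).smul_const h).const_add z
    exact ((hf.differentiable one_ne_zero _).hasFDerivAt).comp_hasDerivAt s h1
  have hc : Continuous fun s : ℝ => fderiv ℝ f (z + s • h) h :=
    (hcont.comp (by fun_prop)).clm_apply continuous_const
  have := intervalIntegral.integral_eq_sub_of_hasDerivAt hder (hc.intervalIntegrable _ _)
  simp only [one_smul, zero_smul, add_zero] at this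
  rw [← this]
  exact sq_integral_unitInterval_le hc

/-- Integrate the pointwise estimate along the segment from z to z + h, swap the integrals, and use
translation invariance at each s. -/
lemma integral_sq_sub_translate_le {f : V → ℝ} (hf : ContDiff ℝ 1 f) (hs : HasCompactSupport f)
    (h : V) :
    ∫ z, (f (z + h) - f z) ^ 2 ∂μ ≤ ∫ z, (fderiv ℝ f z h) ^ 2 ∂μ := by
  have hcont : Continuous (fderiv ℝ f) := hf.continuous_fderiv one_ne_zero
  set g : V → ℝ := fun z => (fderiv ℝ f z h) ^ 2 with hg
  have hgc : Continuous g := (hcont.clm_apply continuous_const).pow 2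
  have hgs : HasCompactSupport g := by
    have : HasCompactSupport fun z => fderiv ℝ f z h := (hs.fderiv ℝ).comp_left
      (g := fun L : V →L[ℝ] ℝ => L h) rfl
    exact this.sq_comp
  have hgi : Integrable g μ := hgc.integrable_of_hasCompactSupport hgs
  have hprod : Integrable (Function.uncurry fun (z : V) (s : ℝ) => g (z + s • h))
      (μ.prod (volume.restrict (Set.Ioc (0 : ℝ) 1))) := by
    have hm : Continuous (Function.uncurry fun (z : V) (s : ℝ) => g (z + s • h)) :=
      hgc.comp (by fun_prop)
    rw [integrable_prod_iff' hm.aestronglyMeasurable]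
    refine ⟨Filter.Eventually.of_forall fun s => hgi.comp_add_right (s • h), ?_⟩
    have : ∀ s : ℝ, ∫ z, ‖g (z + s • h)‖ ∂μ = ∫ z, ‖g z‖ ∂μ := fun s =>
      integral_add_right_eq_self (fun z => ‖g z‖) (s • h)
    simp only [Function.uncurry_apply_pair, this]
    exact integrable_const _
  calc ∫ z, (f (z + h) - f z) ^ 2 ∂μ
      ≤ ∫ z, (∫ s in Set.Ioc (0 : ℝ) 1, g (z + s • h)) ∂μ := by
        refine integral_mono_of_nonneg (Filter.Eventually.of_forall fun z => sq_nonneg _)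
          hprod.integral_prod_left (Filter.Eventually.of_forall fun z => ?_)
        have := sq_sub_translate_le hf h z
        rwa [intervalIntegral.integral_of_le zero_le_one] at this
    _ = ∫ s in Set.Ioc (0 : ℝ) 1, (∫ z, g (z + s • h) ∂μ) := integral_integral_swap hprod
    _ = ∫ z, g z ∂μ := by
        simp only [integral_add_right_eq_self]
        simp

/-- The shear (z, h) ↦ (z, z + h) preserves the product measure and carries the integrand to g ⊗ g.
-/
lemma integral_mul_translate {g : V → ℝ} (hg : Integrable g μ) :
    Integrable (fun h => ∫ z, g z * g (z + h) ∂μ) μ ∧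
      ∫ h, (∫ z, g z * g (z + h) ∂μ) ∂μ = (∫ z, g z ∂μ) ^ 2 := by
  have hp : Integrable (fun p : V × V => g p.1 * g p.2) (μ.prod μ) := hg.mul_prod hg
  have hmp : MeasurePreserving (fun p : V × V => (p.1, p.1 + p.2)) (μ.prod μ) (μ.prod μ) :=
    measurePreserving_prod_add μ μ
  have hq : Integrable (Function.uncurry fun z h => g z * g (z + h)) (μ.prod μ) :=
    hmp.integrable_comp_of_integrable hp
  refine ⟨hq.integral_prod_right, ?_⟩
  rw [← integral_integral_swap hq]
  simp_rw [integral_const_mul, integral_add_left_eq_self]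
  rw [integral_mul_const, sq]

omit [FiniteDimensional ℝ V] in
lemma integrable_of_contDiff_of_hasCompactSupport {f : V → ℝ} (hf : ContDiff ℝ 1 f)
    (hs : HasCompactSupport f) :
    Integrable (fun z => f z ^ 2) μ ∧ Integrable (fun z => ‖fderiv ℝ f z‖ ^ 2) μ :=
  ⟨(hf.continuous.pow 2).integrable_of_hasCompactSupport hs.sq_comp,
  ((hf.continuous_fderiv one_ne_zero).norm.pow 2).integrable_of_hasCompactSupport
    (hs.fderiv ℝ).norm.sq_comp⟩

lemma integral_sq_sub_translate_le_norm {f : V → ℝ} (hf : ContDiff ℝ 1 f)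
    (hs : HasCompactSupport f) {r : ℝ} {h : V} (hh : ‖h‖ ≤ r) :
    ∫ z, (f (z + h) - f z) ^ 2 ∂μ ≤ r ^ 2 * ∫ z, ‖fderiv ℝ f z‖ ^ 2 ∂μ := by
  refine (integral_sq_sub_translate_le hf hs h).trans ?_
  rw [← integral_const_mul]
  refine integral_mono_of_nonneg (Filter.Eventually.of_forall fun z => sq_nonneg _)
    ((integrable_of_contDiff_of_hasCompactSupport hf hs).2.const_mul _)
    (Filter.Eventually.of_forall fun z => ?_)
  change (fderiv ℝ f z h) ^ 2 ≤ r ^ 2 * ‖fderiv ℝ f z‖ ^ 2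
  rw [← sq_abs, ← mul_pow]
  have h1 := (fderiv ℝ f z).le_opNorm h
  rw [Real.norm_eq_abs] at h1
  have h3 : ‖fderiv ℝ f z‖ * ‖h‖ ≤ r * ‖fderiv ℝ f z‖ := by
    rw [mul_comm]
    exact mul_le_mul_of_nonneg_right hh (norm_nonneg _)
  exact pow_le_pow_left₀ (abs_nonneg _) (h1.trans h3) 2

lemma integral_sq_le_translate {f : V → ℝ} (hf : ContDiff ℝ 1 f) (hs : HasCompactSupport f)
    {r : ℝ} {h : V} (hh : ‖h‖ ≤ r) :
    ∫ z, f z ^ 2 ∂μ ≤ r ^ 2 * ∫ z, ‖fderiv ℝ f z‖ ^ 2 ∂μ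
      + 2 * ∫ z, |f z| * |f (z + h)| ∂μ := by
  have hfc := hf.continuous
  have hf2 := (integrable_of_contDiff_of_hasCompactSupport (μ := μ) hf hs).1
  have i1 : Integrable (fun z => (f (z + h) - f z) ^ 2) μ := by
    have hsh : HasCompactSupport fun z => f (z + h) := hs.comp_homeomorph (Homeomorph.addRight h)
    have hsub : HasCompactSupport fun z => f (z + h) - f z := hsh.sub hs
    have hc : Continuous fun z => (f (z + h) - f z) ^ 2 := by fun_prop
    exact hc.integrable_of_hasCompactSupport
      hsub.sq_comp
  have i2 : Integrable (fun z => |f z| * |f (z + h)|) μ := by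
    have hc : Continuous fun z => |f z| * |f (z + h)| := by fun_prop
    have habs : HasCompactSupport fun z => |f z| := hs.norm
    exact hc.integrable_of_hasCompactSupport habs.mul_right
  -- With a = f(z), b = f(z + h): a² = a²/2 + (b - a)²/2 + ab - b²/2; the last term is dropped, and
  -- a²/2 is absorbed on the left at the end.
  have e1 : ∫ z, f z ^ 2 ∂μ ≤ ∫ z, ((1 / 2) * f z ^ 2 + (1 / 2) * (f (z + h) - f z) ^ 2
      + |f z| * |f (z + h)|) ∂μ := by
    refine integral_mono hf2 (((hf2.const_mul _).add (i1.const_mul _)).add i2) fun z => ?_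
    have h1 : f z * f (z + h) ≤ |f z| * |f (z + h)| := by
      rw [← abs_mul]; exact le_abs_self _
    dsimp only
    nlinarith [sq_nonneg (f (z + h))]
  have e3 : ∫ z, ((1 / 2) * f z ^ 2 + (1 / 2) * (f (z + h) - f z) ^ 2
      + |f z| * |f (z + h)|) ∂μ = (1 / 2) * ∫ z, f z ^ 2 ∂μ
      + (1 / 2) * ∫ z, (f (z + h) - f z) ^ 2 ∂μ + ∫ z, |f z| * |f (z + h)| ∂μ := by
    have i12 : Integrable (fun z => (1 / 2) * f z ^ 2 + (1 / 2) * (f (z + h) - f z) ^ 2) μ :=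
      (hf2.const_mul _).add (i1.const_mul _)
    rw [integral_add i12 i2, integral_add (hf2.const_mul _) (i1.const_mul _),
      integral_const_mul, integral_const_mul]
  have e2 := integral_sq_sub_translate_le_norm (μ := μ) hf hs hh
  linarith

/-- The Euclidean Nash inequality at scale `r`. -/
lemma integral_sq_le_fderiv_add {f : V → ℝ} (hf : ContDiff ℝ 1 f) (hs : HasCompactSupport f)
    {r : ℝ} (hr : 0 < r) :
    ∫ z, f z ^ 2 ∂μ ≤ r ^ 2 * ∫ z, ‖fderiv ℝ f z‖ ^ 2 ∂μ
      + 2 / μ.real (Metric.ball 0 r) * (∫ z, |f z| ∂μ) ^ 2 := by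
  have hfi : Integrable f μ := hf.continuous.integrable_of_hasCompactSupport hs
  obtain ⟨hK, hKint⟩ := integral_mul_translate hfi.abs
  have key : ∀ h ∈ Metric.ball (0 : V) r, ∫ z, f z ^ 2 ∂μ - r ^ 2 * ∫ z, ‖fderiv ℝ f z‖ ^ 2 ∂μ
      ≤ 2 * ∫ z, |f z| * |f (z + h)| ∂μ := by
    intro h hh
    have := integral_sq_le_translate (μ := μ) hf hs (mem_ball_zero_iff.1 hh).le
    linarith
  have hV : 0 < μ.real (Metric.ball (0 : V) r) :=
    ENNReal.toReal_pos (Metric.measure_ball_pos μ 0 hr).ne' measure_ball_lt_top.ne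
  generalize ∫ z, f z ^ 2 ∂μ = F at key ⊢
  generalize ∫ z, ‖fderiv ℝ f z‖ ^ 2 ∂μ = G at key ⊢
  -- Integrate `key` over h in the ball, then enlarge the ball to the whole space on the right,
  -- where the correlation integrates to the squared L¹ norm.
  have hfin : (F - r ^ 2 * G) * μ.real (Metric.ball (0 : V) r) ≤ 2 * (∫ z, |f z| ∂μ) ^ 2 := by
    calc (F - r ^ 2 * G) * μ.real (Metric.ball (0 : V) r)
        = ∫ _ in Metric.ball (0 : V) r, (F - r ^ 2 * G) ∂μ := by
          rw [setIntegral_const, smul_eq_mul, mul_comm]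
      _ ≤ ∫ h in Metric.ball (0 : V) r, 2 * ∫ z, |f z| * |f (z + h)| ∂μ ∂μ := by
          refine setIntegral_mono_on (integrableOn_const measure_ball_lt_top.ne)
            (hK.const_mul 2).integrableOn measurableSet_ball key
      _ ≤ ∫ h, 2 * ∫ z, |f z| * |f (z + h)| ∂μ ∂μ := setIntegral_le_integral (hK.const_mul 2)
          (Filter.Eventually.of_forall fun h =>
            mul_nonneg zero_le_two (integral_nonneg fun z => by positivity))
      _ = 2 * (∫ z, |f z| ∂μ) ^ 2 := by rw [integral_const_mul, hKint]
  rw [← le_div_iff₀ hV, mul_div_right_comm] at hfin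
  linarith

end Euclidean

/-! ### Weights and energy density -/

variable {n m : ℕ} {α : ℝ} {β : Fin m → ℝ}

/-- The diagonal entries of the Grušin matrix. -/
def weight (α : ℝ) (β : Fin m → ℝ) (z : Space n m) : Fin n ⊕ Fin m → ℝ :=
  Sum.elim (fun _ => firstNorm z ^ α) (fun j => firstNorm z ^ β j)

/-- The density `⟨∇f, A ∇f⟩` of the Grušin form. -/
def energyDensity {𝕜 : Type*} [RCLike 𝕜] (α : ℝ) (β : Fin m → ℝ) (f : Space n m → 𝕜)
    (z : Space n m) : ℝ :=
  ∑ k, weight α β z k * ‖euclGrad f z k‖ ^ 2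

lemma firstNorm_nonneg (z : Space n m) : 0 ≤ firstNorm z := Real.sqrt_nonneg _

lemma firstNorm_sq (z : Space n m) : firstNorm z ^ 2 = ∑ i : Fin n, z (Sum.inl i) ^ 2 :=
  Real.sq_sqrt (Finset.sum_nonneg fun _ _ => sq_nonneg _)

lemma sq_coord_le (z : Space n m) (i : Fin n) : z (Sum.inl i) ^ 2 ≤ firstNorm z ^ 2 := by
  rw [firstNorm_sq]
  exact Finset.single_le_sum (f := fun i : Fin n => z (Sum.inl i) ^ 2)
    (fun _ _ => sq_nonneg _) (Finset.mem_univ i)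

lemma continuous_firstNorm : Continuous (firstNorm : Space n m → ℝ) := by
  unfold firstNorm
  fun_prop

lemma weight_nonneg (z : Space n m) (k : Fin n ⊕ Fin m) : 0 ≤ weight α β z k := by
  cases k <;> exact Real.rpow_nonneg (firstNorm_nonneg z) _

lemma continuous_weight (hα : 0 ≤ α) (hβ : ∀ j, 0 ≤ β j) (k : Fin n ⊕ Fin m) :
    Continuous fun z : Space n m => weight α β z k := by
  cases k with
  | inl i => exact continuous_firstNorm.rpow_const fun _ => Or.inr hα
  | inr j => exact continuous_firstNorm.rpow_const fun _ => Or.inr (hβ j)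

lemma one_le_weight (hα : 0 ≤ α) (hβ : ∀ j, 0 ≤ β j) {z : Space n m} (hz : 1 ≤ firstNorm z)
    (k : Fin n ⊕ Fin m) : 1 ≤ weight α β z k := by
  cases k with
  | inl i => exact Real.one_le_rpow hz hα
  | inr j => exact Real.one_le_rpow hz (hβ j)

/-- Since 2 - α lies in (0, 2], the factor |x|^(2-α) is at most 2 when |x|² ≤ 2. This is the Hardy
weight bound near the degenerate set. -/
lemma sq_coord_le_two_mul_weight (hα : 0 ≤ α) (hα2 : α < 2) {z : Space n m}
    (hz : firstNorm z ^ 2 ≤ 2) (i : Fin n) :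
    z (Sum.inl i) ^ 2 ≤ 2 * weight α β z (Sum.inl i) := by
  refine (sq_coord_le z i).trans ?_
  change firstNorm z ^ 2 ≤ 2 * firstNorm z ^ α
  rcases (firstNorm_nonneg z).eq_or_lt with h0 | h0
  · rw [← h0]
    have := Real.rpow_nonneg (le_refl (0 : ℝ)) α
    nlinarith
  have hsplit : firstNorm z ^ 2 = firstNorm z ^ (2 - α) * firstNorm z ^ α := by
    rw [← Real.rpow_add h0, ← Real.rpow_natCast]
    norm_num
  have hle : firstNorm z ^ (2 - α) ≤ 2 := by
    rcases le_total (firstNorm z) 1 with h1 | h1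
    · exact (Real.rpow_le_one h0.le h1 (by linarith)).trans one_le_two
    · calc firstNorm z ^ (2 - α) ≤ firstNorm z ^ (2 : ℝ) :=
          Real.rpow_le_rpow_of_exponent_le h1 (by linarith)
        _ ≤ 2 := by rwa [Real.rpow_two]
  rw [hsplit]
  exact mul_le_mul_of_nonneg_right hle (Real.rpow_nonneg h0.le _)

section Gradient

variable {𝕜 : Type*} [RCLike 𝕜]

lemma energyDensity_nonneg (f : Space n m → 𝕜) (z : Space n m) : 0 ≤ energyDensity α β f z :=
  Finset.sum_nonneg fun k _ => mul_nonneg (weight_nonneg z k) (sq_nonneg _)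

lemma continuous_euclGrad {f : Space n m → 𝕜} (hf : ContDiff ℝ 1 f) (k : Fin n ⊕ Fin m) :
    Continuous fun z => euclGrad f z k :=
  (hf.continuous_fderiv one_ne_zero).clm_apply continuous_const

lemma hasCompactSupport_euclGrad {f : Space n m → 𝕜} (hs : HasCompactSupport f)
    (k : Fin n ⊕ Fin m) : HasCompactSupport fun z => euclGrad f z k :=
  (hs.fderiv ℝ).comp_left (g := fun L : Space n m →L[ℝ] 𝕜 => L (EuclideanSpace.single k 1)) rfl

lemma integrable_energyDensity (hα : 0 ≤ α) (hβ : ∀ j, 0 ≤ β j) {f : Space n m → 𝕜}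
    (hf : ContDiff ℝ 1 f) (hs : HasCompactSupport f) : Integrable (energyDensity α β f) := by
  unfold energyDensity
  refine integrable_finsetSum _ fun k _ => ?_
  have hn : HasCompactSupport fun z => ‖euclGrad f z k‖ ^ 2 :=
    (hasCompactSupport_euclGrad hs k).norm.sq_comp
  exact ((continuous_weight hα hβ k).mul
    ((continuous_euclGrad hf k).norm.pow 2)).integrable_of_hasCompactSupport hn.mul_left

end Gradient

lemma norm_fderiv_sq_le (f : Space n m → ℝ) (z : Space n m) :
    ‖fderiv ℝ f z‖ ^ 2 ≤ ∑ k, euclGrad f z k ^ 2 := by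
  have hnn : 0 ≤ ∑ k, euclGrad f z k ^ 2 := Finset.sum_nonneg fun _ _ => sq_nonneg _
  have hle : ‖fderiv ℝ f z‖ ≤ √(∑ k, euclGrad f z k ^ 2) := by
    refine ContinuousLinearMap.opNorm_le_bound _ (Real.sqrt_nonneg _) fun v => ?_
    have hv : fderiv ℝ f z v = ∑ k, euclGrad f z k * v k := by
      conv_lhs => rw [← (EuclideanSpace.basisFun (Fin n ⊕ Fin m) ℝ).sum_repr v]
      rw [map_sum]
      refine Finset.sum_congr rfl fun k _ => ?_
      simp [euclGrad, mul_comm]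
    rw [hv, Real.norm_eq_abs, EuclideanSpace.norm_eq, ← Real.sqrt_mul hnn]
    refine Real.abs_le_sqrt ?_
    simpa using Finset.sum_mul_sq_le_sq_mul_sq Finset.univ (euclGrad f z) v
  calc ‖fderiv ℝ f z‖ ^ 2 ≤ √(∑ k, euclGrad f z k ^ 2) ^ 2 :=
        pow_le_pow_left₀ (norm_nonneg _) hle 2
    _ = _ := Real.sq_sqrt hnn

/-! ### The cutoff and its derivative bounds -/

lemma exists_deriv_smoothTransition_bound : ∃ M : ℝ, 0 ≤ M ∧
    (∀ t, |deriv Real.smoothTransition t| ≤ M) ∧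
    ∀ t, 1 < t → deriv Real.smoothTransition t = 0 := by
  have hc : Continuous (deriv Real.smoothTransition) :=
    (Real.smoothTransition.contDiff (n := 1)).continuous_deriv le_rfl
  have h1 : ∀ t, 1 < t → deriv Real.smoothTransition t = 0 := by
    intro t ht
    have : Real.smoothTransition =ᶠ[nhds t] fun _ => 1 := by
      filter_upwards [lt_mem_nhds ht] with s hs using Real.smoothTransition.one_of_one_le hs.le
    rw [this.deriv_eq, deriv_const]
  have h0 : ∀ t, t < 0 → deriv Real.smoothTransition t = 0 := by
    intro t ht
    have : Real.smoothTransition =ᶠ[nhds t] fun _ => 0 := by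
      filter_upwards [gt_mem_nhds ht] with s hs using Real.smoothTransition.zero_of_nonpos hs.le
    rw [this.deriv_eq, deriv_const]
  obtain ⟨M, hM⟩ := isCompact_Icc.exists_bound_of_continuousOn (s := Set.Icc (0 : ℝ) 1)
    hc.continuousOn
  have hM0 : 0 ≤ M := (norm_nonneg _).trans (hM 0 (by simp))
  refine ⟨M, hM0, fun t => ?_, h1⟩
  by_cases ht : t ∈ Set.Icc (0 : ℝ) 1
  · exact hM t ht
  · rw [Set.mem_Icc, not_and_or, not_le, not_le] at ht
    rcases ht with ht | ht
    · simpa [h0 t ht] using hM0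
    · simpa [h1 t ht] using hM0

/-- A smooth cutoff in the first block of variables, removing the degenerate set. -/
def cutoff (z : Space n m) : ℝ := Real.smoothTransition ((∑ i : Fin n, z (Sum.inl i) ^ 2) - 1)

lemma contDiff_cutoff : ContDiff ℝ 1 (cutoff : Space n m → ℝ) := by
  unfold cutoff
  exact (Real.smoothTransition.contDiff (n := 1)).comp (by fun_prop)

lemma cutoff_nonneg (z : Space n m) : 0 ≤ cutoff z := Real.smoothTransition.nonneg _

lemma cutoff_le_one (z : Space n m) : cutoff z ≤ 1 := Real.smoothTransition.le_one _

lemma cutoff_eq_zero {z : Space n m} (hz : firstNorm z ≤ 1) : cutoff z = 0 := by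
  refine Real.smoothTransition.zero_of_nonpos ?_
  rw [← firstNorm_sq]
  nlinarith [firstNorm_nonneg z]

lemma cutoff_eq_one {z : Space n m} (hz : 2 ≤ firstNorm z ^ 2) : cutoff z = 1 := by
  refine Real.smoothTransition.one_of_one_le ?_
  rw [← firstNorm_sq]
  linarith

lemma euclGrad_cutoff (z : Space n m) (k : Fin n ⊕ Fin m) :
    euclGrad cutoff z k = deriv Real.smoothTransition (firstNorm z ^ 2 - 1)
      * Sum.elim (fun i => 2 * z (Sum.inl i)) (fun _ => 0) k := by
  have hS : HasFDerivAt (fun z : Space n m => (∑ i : Fin n, z (Sum.inl i) ^ 2) - 1)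
      (∑ i : Fin n, (2 * z (Sum.inl i)) • (EuclideanSpace.proj (Sum.inl i) :
        Space n m →L[ℝ] ℝ)) z := by
    refine HasFDerivAt.sub_const _ (HasFDerivAt.fun_sum fun i _ => ?_)
    have := ((EuclideanSpace.proj (Sum.inl i) : Space n m →L[ℝ] ℝ).hasFDerivAt (x := z)).pow 2
    simpa using this
  have hψ : HasDerivAt Real.smoothTransition (deriv Real.smoothTransition (firstNorm z ^ 2 - 1))
      ((∑ i : Fin n, z (Sum.inl i) ^ 2) - 1) := by
    rw [← firstNorm_sq]
    exact ((Real.smoothTransition.contDiff (n := 1)).differentiable one_ne_zero _).hasDerivAt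
  have := (hψ.comp_hasFDerivAt z hS).fderiv
  unfold euclGrad cutoff
  change fderiv ℝ (Real.smoothTransition ∘ fun z : Space n m =>
    (∑ i : Fin n, z (Sum.inl i) ^ 2) - 1) z _ = _
  rw [this]
  cases k with
  | inl i => simp [Finset.sum_ite_eq', PiLp.single_apply]
  | inr j => simp

/-- The gradient of the cutoff vanishes for |x|² > 2, so x_i stays bounded wherever it matters. The
first bound serves the product rule for χf, the second the Hardy inequality. -/
lemma exists_euclGrad_cutoff_bound (n m : ℕ) : ∃ M : ℝ, 0 ≤ M ∧
    (∀ (z : Space n m) k, |euclGrad cutoff z k| ≤ M) ∧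
    ∀ (z : Space n m) i, |z (Sum.inl i) * euclGrad cutoff z (Sum.inl i)| ≤ M := by
  obtain ⟨M, hM0, hM, hM1⟩ := exists_deriv_smoothTransition_bound
  have key : ∀ (z : Space n m) i, |euclGrad cutoff z (Sum.inl i)| ≤ 4 * M ∧
      |z (Sum.inl i) * euclGrad cutoff z (Sum.inl i)| ≤ 4 * M := by
    intro z i
    rw [euclGrad_cutoff, Sum.elim_inl]
    by_cases hz : 1 < firstNorm z ^ 2 - 1
    · simp [hM1 _ hz, hM0]
    · have h1 := sq_coord_le z i
      have h2 : z (Sum.inl i) ^ 2 ≤ 2 := by linarith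
      have h3 : |z (Sum.inl i)| ≤ 2 := abs_le_of_sq_le_sq (by linarith) zero_le_two
      have h4 := hM (firstNorm z ^ 2 - 1)
      have h5 := abs_nonneg (deriv Real.smoothTransition (firstNorm z ^ 2 - 1))
      constructor
      · rw [abs_mul, abs_mul, abs_two]
        nlinarith [abs_nonneg (z (Sum.inl i))]
      · have : z (Sum.inl i) * (deriv Real.smoothTransition (firstNorm z ^ 2 - 1)
            * (2 * z (Sum.inl i))) = deriv Real.smoothTransition (firstNorm z ^ 2 - 1)
            * (2 * z (Sum.inl i) ^ 2) := by ring
        rw [this, abs_mul, abs_of_nonneg (by positivity : 0 ≤ 2 * z (Sum.inl i) ^ 2)]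
        nlinarith [sq_nonneg (z (Sum.inl i))]
  refine ⟨4 * M, by positivity, fun z k => ?_, fun z i => (key z i).2⟩
  cases k with
  | inl i => exact (key z i).1
  | inr j => simpa [euclGrad_cutoff] using hM0

lemma cutoff_sq_le_weight (hα : 0 ≤ α) (hβ : ∀ j, 0 ≤ β j) (z : Space n m)
    (k : Fin n ⊕ Fin m) : cutoff z ^ 2 ≤ weight α β z k := by
  rcases le_total (firstNorm z) 1 with h | h
  · rw [cutoff_eq_zero h]
    simpa using weight_nonneg z k
  · exact (pow_le_one₀ (cutoff_nonneg z) (cutoff_le_one z)).trans (one_le_weight hα hβ h k)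

lemma one_sub_cutoff_sq_mul_le (hα : 0 ≤ α) (hα2 : α < 2) (z : Space n m) (i : Fin n) :
    (1 - cutoff z ^ 2) * z (Sum.inl i) ^ 2 ≤ 2 * weight α β z (Sum.inl i) := by
  rcases le_total (firstNorm z ^ 2) 2 with h | h
  · refine le_trans ?_ (sq_coord_le_two_mul_weight hα hα2 h i)
    nlinarith [sq_nonneg (z (Sum.inl i)), sq_nonneg (cutoff z)]
  · rw [cutoff_eq_one h]
    have := weight_nonneg (α := α) (β := β) z (Sum.inl i)
    linarith

/-! ### Hardy inequality and the unit-scale bound -/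

lemma energyDensity_real (f : Space n m → ℝ) (z : Space n m) :
    energyDensity α β f z = ∑ k, weight α β z k * euclGrad f z k ^ 2 := by
  simp [energyDensity]

lemma euclGrad_mul {f g : Space n m → ℝ} (hf : ContDiff ℝ 1 f) (hg : ContDiff ℝ 1 g)
    (z : Space n m) (k : Fin n ⊕ Fin m) :
    euclGrad (fun z => f z * g z) z k = euclGrad f z k * g z + f z * euclGrad g z k := by
  have h := ((hf.differentiable one_ne_zero z).hasFDerivAt.mul
    (hg.differentiable one_ne_zero z).hasFDerivAt).fderiv
  unfold euclGrad
  change fderiv ℝ (f * g) z _ = _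
  rw [h]
  simp only [add_apply, smul_apply, smul_eq_mul]
  ring

lemma integral_euclGrad_eq_zero {g : Space n m → ℝ} (hg : ContDiff ℝ 1 g)
    (hs : HasCompactSupport g) (k : Fin n ⊕ Fin m) : ∫ z, euclGrad g z k = 0 := by
  have hi := (continuous_euclGrad hg k).integrable_of_hasCompactSupport
    (μ := volume) (hasCompactSupport_euclGrad hs k)
  have h := integral_mul_fderiv_eq_neg_fderiv_mul_of_integrable (μ := (volume : Measure (Space n m)))
    (f := fun _ => (1 : ℝ)) (g := g) (v := EuclideanSpace.single k 1) (by simp)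
    (by simpa [euclGrad] using hi)
    (by simpa using hg.continuous.integrable_of_hasCompactSupport hs)
    (fun _ _ => differentiableAt_const _) (fun _ _ => hg.differentiable one_ne_zero _)
  simpa [euclGrad] using h

lemma euclGrad_coord (z : Space n m) (k : Fin n ⊕ Fin m) :
    euclGrad (fun z : Space n m => z k) z k = 1 := by
  have := (EuclideanSpace.proj k : Space n m →L[ℝ] ℝ).hasFDerivAt (x := z) |>.fderiv
  unfold euclGrad
  change fderiv ℝ (EuclideanSpace.proj k : Space n m →L[ℝ] ℝ) z _ = 1
  rw [this]
  simp

/-- A Hardy type inequality: the mass near the degenerate set is controlled by the mass away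
from it and the energy. -/
lemma integral_sq_le_cutoff (hα : 0 ≤ α) (hα2 : α < 2) (hβ : ∀ j, 0 ≤ β j) (i : Fin n)
    {M : ℝ} (hM : ∀ z : Space n m, |z (Sum.inl i) * euclGrad cutoff z (Sum.inl i)| ≤ M)
    {f : Space n m → ℝ} (hf : ContDiff ℝ 1 f) (hs : HasCompactSupport f) :
    3 / 8 * ∫ z, f z ^ 2 ≤ (8 * M ^ 2 + 1 / 2) * (∫ z, (cutoff z * f z) ^ 2)
      + 4 * ∫ z, energyDensity α β f z := by
  set k : Fin n ⊕ Fin m := Sum.inl i with hk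
  have hχ : ContDiff ℝ 1 (cutoff : Space n m → ℝ) := contDiff_cutoff
  set φ : Space n m → ℝ := fun z => 1 - cutoff z * cutoff z with hφ
  have hφ1 : ContDiff ℝ 1 φ := contDiff_const.sub (hχ.mul hχ)
  have hx : ContDiff ℝ 1 fun z : Space n m => z k := by fun_prop
  have hg1 : ContDiff ℝ 1 fun z : Space n m => φ z * z k := hφ1.mul hx
  have hff : ContDiff ℝ 1 fun z => f z * f z := hf.mul hf
  have hg : ContDiff ℝ 1 fun z : Space n m => φ z * z k * (f z * f z) := hg1.mul hff
  have hsff : HasCompactSupport fun z => f z * f z := hs.mul_right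
  have hgs : HasCompactSupport fun z : Space n m => φ z * z k * (f z * f z) := hsff.mul_left
  -- The derivative of φ x_i f² in direction x_i has integral zero; its expansion contains φ f², the
  -- mass near the degenerate set.
  have hzero := integral_euclGrad_eq_zero hg hgs k
  have hgi : Integrable fun z => euclGrad (fun z : Space n m => φ z * z k * (f z * f z)) z k :=
    (continuous_euclGrad hg k).integrable_of_hasCompactSupport (hasCompactSupport_euclGrad hgs k)
  have hgrad : ∀ z, euclGrad (fun z : Space n m => φ z * z k * (f z * f z)) z k
      = (-(2 * cutoff z * euclGrad cutoff z k) * z k + φ z) * (f z * f z)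
        + φ z * z k * (2 * f z * euclGrad f z k) := by
    intro z
    have hφz : euclGrad φ z k = -(2 * cutoff z * euclGrad cutoff z k) := by
      have : euclGrad φ z k = - euclGrad (fun z => cutoff z * cutoff z) z k := by
        unfold euclGrad
        rw [hφ, fderiv_const_sub]
        rfl
      rw [this, euclGrad_mul hχ hχ]
      ring
    rw [euclGrad_mul hg1 hff, euclGrad_mul hφ1 hx, euclGrad_mul hf hf, euclGrad_coord, hφz]
    ring
  -- Solve the expansion for φ f². Young's inequality costs φ f²/2 for the term with ∂f and f²/8 for
  -- the term with ∂χ. As φ f² = f² - (χf)², this leaves 1/2 - 1/8 = 3/8.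
  have hpt : ∀ z, 3 / 8 * f z ^ 2 ≤ (8 * M ^ 2 + 1 / 2) * (cutoff z * f z) ^ 2
      + 4 * energyDensity α β f z
      + euclGrad (fun z : Space n m => φ z * z k * (f z * f z)) z k := by
    intro z
    rw [hgrad]
    have hχ0 := cutoff_nonneg z
    have hχ1 := cutoff_le_one z
    have hφ0 : 0 ≤ φ z := by simp only [hφ]; nlinarith
    have hE : weight α β z k * euclGrad f z k ^ 2 ≤ energyDensity α β f z := by
      rw [energyDensity_real]
      exact Finset.single_le_sum (f := fun k => weight α β z k * euclGrad f z k ^ 2)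
        (fun k _ => mul_nonneg (weight_nonneg z k) (sq_nonneg _)) (Finset.mem_univ k)
    have h1 : φ z * z k ^ 2 * euclGrad f z k ^ 2 ≤ 2 * energyDensity α β f z := by
      have := one_sub_cutoff_sq_mul_le (β := β) hα hα2 z i
      have h2 : φ z * z k ^ 2 ≤ 2 * weight α β z k := by simpa only [hφ, ← sq] using this
      nlinarith [mul_le_mul_of_nonneg_right h2 (sq_nonneg (euclGrad f z k))]
    have h2 : -(φ z * z k * (2 * f z * euclGrad f z k))
        ≤ 1 / 2 * (φ z * f z ^ 2) + 2 * (φ z * z k ^ 2 * euclGrad f z k ^ 2) := by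
      nlinarith [mul_nonneg hφ0 (sq_nonneg (f z + 2 * (z k * euclGrad f z k)))]
    have h3 : 2 * cutoff z * euclGrad cutoff z k * z k ≤ 1 / 8 + 8 * M ^ 2 * cutoff z ^ 2 := by
      have h4 := (abs_le.1 (hM z)).2
      have h5 : cutoff z * (z k * euclGrad cutoff z k) ≤ cutoff z * M :=
        mul_le_mul_of_nonneg_left h4 hχ0
      nlinarith [sq_nonneg (8 * (M * cutoff z) - 1)]
    have h6 := mul_le_mul_of_nonneg_right h3 (sq_nonneg (f z))
    have h7 : φ z * f z ^ 2 = f z ^ 2 - (cutoff z * f z) ^ 2 := by simp only [hφ]; ring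
    nlinarith
  have i1 : Integrable fun z => f z ^ 2 :=
    (integrable_of_contDiff_of_hasCompactSupport hf hs).1
  have hsc : HasCompactSupport fun z => cutoff z * f z := hs.mul_left
  have i2 : Integrable fun z => (cutoff z * f z) ^ 2 :=
    (integrable_of_contDiff_of_hasCompactSupport (hχ.mul hf) hsc).1
  have i3 := integrable_energyDensity hα hβ hf hs
  have i4 : Integrable fun z => (8 * M ^ 2 + 1 / 2) * (cutoff z * f z) ^ 2
      + 4 * energyDensity α β f z := (i2.const_mul _).add (i3.const_mul _)
  have hint := integral_mono (i1.const_mul (3 / 8)) (i4.add hgi) hpt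
  simp only [Pi.add_apply] at hint
  rw [integral_const_mul, integral_add i4 hgi, hzero, integral_add (i2.const_mul _)
    (i3.const_mul _), integral_const_mul, integral_const_mul] at hint
  linarith

/-- In each coordinate, (∂(χf))² ≤ 2χ²(∂f)² + 2(∂χ)²f², and χ² is at most every weight. -/
lemma integral_norm_fderiv_cutoff_mul_le (hα : 0 ≤ α) (hβ : ∀ j, 0 ≤ β j)
    {M : ℝ} (hM : ∀ (z : Space n m) k, |euclGrad cutoff z k| ≤ M)
    {f : Space n m → ℝ} (hf : ContDiff ℝ 1 f) (hs : HasCompactSupport f) :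
    ∫ z, ‖fderiv ℝ (fun z => cutoff z * f z) z‖ ^ 2
      ≤ 2 * (∫ z, energyDensity α β f z) + 2 * (n + m) * M ^ 2 * ∫ z, f z ^ 2 := by
  have hχ : ContDiff ℝ 1 (cutoff : Space n m → ℝ) := contDiff_cutoff
  have i1 : Integrable fun z => f z ^ 2 :=
    (integrable_of_contDiff_of_hasCompactSupport hf hs).1
  have i3 := integrable_energyDensity hα hβ hf hs
  rw [← integral_const_mul, ← integral_const_mul,
    ← integral_add (i3.const_mul _) (i1.const_mul _)]
  refine integral_mono_of_nonneg (Filter.Eventually.of_forall fun z => sq_nonneg _)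
    ((i3.const_mul _).add (i1.const_mul _)) (Filter.Eventually.of_forall fun z => ?_)
  refine (norm_fderiv_sq_le _ z).trans ?_
  have hcard : 2 * (n + m : ℝ) * M ^ 2 * f z ^ 2
      = ∑ _k : Fin n ⊕ Fin m, 2 * M ^ 2 * f z ^ 2 := by
    simp only [Finset.sum_const, Finset.card_univ, Fintype.card_sum, Fintype.card_fin,
      nsmul_eq_mul]
    push_cast
    ring
  dsimp only
  rw [energyDensity_real, Finset.mul_sum, hcard, ← Finset.sum_add_distrib]
  refine Finset.sum_le_sum fun k _ => ?_
  rw [euclGrad_mul hχ hf]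
  have h1 : euclGrad cutoff z k ^ 2 ≤ M ^ 2 := sq_le_sq.2 ((hM z k).trans (le_abs_self M))
  have h2 := mul_le_mul_of_nonneg_right h1 (sq_nonneg (f z))
  have h3 := mul_le_mul_of_nonneg_right (cutoff_sq_le_weight hα hβ z k)
    (sq_nonneg (euclGrad f z k))
  nlinarith [sq_nonneg (euclGrad cutoff z k * f z - cutoff z * euclGrad f z k)]

/-- The Nash inequality at unit scale. -/
lemma exists_unit_scale_bound (hα : 0 ≤ α) (hα2 : α < 2) (hβ : ∀ j, 0 ≤ β j)
    (hn : n = 0 → ∀ j, β j = 0) :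
    ∃ C : ℝ, 0 ≤ C ∧ ∀ f : Space n m → ℝ, ContDiff ℝ 1 f → HasCompactSupport f →
      ∫ z, f z ^ 2 ≤ C * ((∫ z, energyDensity α β f z) + (∫ z, |f z|) ^ 2) := by
  have hEnn : ∀ f : Space n m → ℝ, 0 ≤ ∫ z, energyDensity α β f z := fun f =>
    integral_nonneg fun z => energyDensity_nonneg f z
  rcases Nat.eq_zero_or_pos n with h0 | h0
  -- Without x variables every weight is 0^0 = 1, so the Euclidean inequality at r = 1 suffices.
  · subst h0
    set V := (volume : Measure (Space 0 m)).real (Metric.ball 0 1)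
    have hV : 0 ≤ 2 / V := by positivity
    refine ⟨1 + 2 / V, by positivity, fun f hf hs => ?_⟩
    have h1 := integral_sq_le_fderiv_add (μ := (volume : Measure (Space 0 m))) hf hs one_pos
    have h2 : ∫ z, ‖fderiv ℝ f z‖ ^ 2 ≤ ∫ z, energyDensity α β f z := by
      refine integral_mono (integrable_of_contDiff_of_hasCompactSupport hf hs).2
        (integrable_energyDensity hα hβ hf hs) fun z => ?_
      refine (norm_fderiv_sq_le f z).trans_eq ?_
      rw [energyDensity_real]
      refine Finset.sum_congr rfl fun k _ => ?_
      rcases k with i | j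
      · exact i.elim0
      · simp [weight, hn rfl j]
    nlinarith [mul_nonneg hV (hEnn f), sq_nonneg (∫ z, |f z|)]
  · obtain ⟨M, hM0, hM1, hM2⟩ := exists_euclGrad_cutoff_bound n m
    set a : ℝ := 8 * M ^ 2 + 1 / 2 with ha
    have ha0 : 0 < a := by positivity
    set b : ℝ := (n + m) * M ^ 2 with hb
    have hb0 : 0 ≤ b := by positivity
    -- This makes a r²(2E + 2bF) ≤ (E + F)/8, so F/8 is absorbed into the 3/8 F of the Hardy
    -- inequality.
    set r : ℝ := √(1 / (16 * a * (b + 1))) with hr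
    have hr2 : r ^ 2 = 1 / (16 * a * (b + 1)) := Real.sq_sqrt (by positivity)
    have hr0 : 0 < r := Real.sqrt_pos.2 (by positivity)
    set V := (volume : Measure (Space n m)).real (Metric.ball 0 r)
    have hV : 0 ≤ 2 / V := by positivity
    refine ⟨4 * (5 + a * (2 / V)), by positivity, fun f hf hs => ?_⟩
    have hsc : HasCompactSupport fun z => cutoff z * f z := hs.mul_left
    have h1 := integral_sq_le_fderiv_add (μ := (volume : Measure (Space n m)))
      (contDiff_cutoff.mul hf) hsc hr0
    have h2 := integral_norm_fderiv_cutoff_mul_le hα hβ hM1 hf hs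
    have h3 := integral_sq_le_cutoff hα hα2 hβ ⟨0, h0⟩ (fun z => hM2 z _) hf hs
    have h4 : ∫ z, |cutoff z * f z| ≤ ∫ z, |f z| := by
      refine integral_mono_of_nonneg (Filter.Eventually.of_forall fun z => abs_nonneg _)
        (hf.continuous.integrable_of_hasCompactSupport hs).abs
        (Filter.Eventually.of_forall fun z => ?_)
      dsimp only
      rw [abs_mul, abs_of_nonneg (cutoff_nonneg z)]
      exact mul_le_of_le_one_left (abs_nonneg _) (cutoff_le_one z)
    have h5 : (∫ z, |cutoff z * f z|) ^ 2 ≤ (∫ z, |f z|) ^ 2 :=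
      pow_le_pow_left₀ (integral_nonneg fun z => abs_nonneg _) h4 2
    have hE := hEnn f
    have hF : 0 ≤ ∫ z, f z ^ 2 := integral_nonneg fun z => sq_nonneg _
    have hN : 0 ≤ (∫ z, |f z|) ^ 2 := sq_nonneg _
    generalize (∫ z, |cutoff z * f z|) ^ 2 = N' at *
    generalize (∫ z, |f z|) ^ 2 = N at *
    generalize ∫ z, (cutoff z * f z) ^ 2 = X at *
    generalize ∫ z, ‖fderiv ℝ (fun z => cutoff z * f z) z‖ ^ 2 = G at *
    generalize ∫ z, f z ^ 2 = F at *
    generalize ∫ z, energyDensity α β f z = E at *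
    have h6 : a * X ≤ a * r ^ 2 * (2 * E + 2 * b * F) + a * (2 / V) * N := by
      have e1 : r ^ 2 * G ≤ r ^ 2 * (2 * E + 2 * b * F) := by
        refine mul_le_mul_of_nonneg_left ?_ (sq_nonneg r)
        rw [hb]; linarith
      have e2 : 2 / V * N' ≤ 2 / V * N := mul_le_mul_of_nonneg_left h5 hV
      have e3 : X ≤ r ^ 2 * (2 * E + 2 * b * F) + 2 / V * N := by linarith
      have := mul_le_mul_of_nonneg_left e3 ha0.le
      linarith
    have h7 : a * r ^ 2 * (2 * E + 2 * b * F) ≤ 1 / 8 * (E + F) := by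
      have e1 : a * r ^ 2 = 1 / (16 * (b + 1)) := by
        rw [hr2]; field_simp
      rw [e1, div_mul_eq_mul_div, div_le_iff₀ (by positivity)]
      nlinarith [mul_nonneg hb0 hE]
    have h8 : 0 ≤ a * (2 / V) := by positivity
    nlinarith [mul_nonneg h8 hE]

/-! ### Anisotropic dilations -/

section Dilation

/-- The diagonal linear map with entries `s`. -/
def diagMap (s : Fin n ⊕ Fin m → ℝ) : Space n m →ₗ[ℝ] Space n m :=
  Matrix.toLin (EuclideanSpace.basisFun _ ℝ).toBasis (EuclideanSpace.basisFun _ ℝ).toBasis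
    (Matrix.diagonal s)

lemma diagMap_single (s : Fin n ⊕ Fin m → ℝ) (k : Fin n ⊕ Fin m) :
    diagMap s (EuclideanSpace.single k 1) = s k • EuclideanSpace.single k 1 := by
  have := Matrix.toLin_self (EuclideanSpace.basisFun (Fin n ⊕ Fin m) ℝ).toBasis
    (EuclideanSpace.basisFun (Fin n ⊕ Fin m) ℝ).toBasis (Matrix.diagonal s) k
  simpa [diagMap, Matrix.diagonal_apply, ite_smul, Finset.sum_ite_eq'] using this

lemma diagMap_apply (s : Fin n ⊕ Fin m → ℝ) (z : Space n m) (k : Fin n ⊕ Fin m) :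
    diagMap s z k = s k * z k := by
  conv_lhs => rw [← (EuclideanSpace.basisFun (Fin n ⊕ Fin m) ℝ).sum_repr z]
  rw [map_sum]
  simp only [map_smul, diagMap_single, WithLp.ofLp_sum, Finset.sum_apply, PiLp.smul_apply,
    EuclideanSpace.basisFun_apply, EuclideanSpace.basisFun_repr,
    PiLp.single_apply, smul_eq_mul, mul_ite, mul_one, mul_zero, Finset.sum_ite_eq,
    Finset.mem_univ, if_true, mul_comm (s k)]

lemma det_diagMap (s : Fin n ⊕ Fin m → ℝ) : LinearMap.det (diagMap s) = ∏ k, s k := by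
  rw [diagMap, LinearMap.det_toLin, Matrix.det_diagonal]

lemma continuous_diagMap (s : Fin n ⊕ Fin m → ℝ) : Continuous (diagMap s) :=
  LinearMap.continuous_of_finiteDimensional _

lemma integral_comp_diagMap {s : Fin n ⊕ Fin m → ℝ} (hs : ∀ k, 0 < s k) {g : Space n m → ℝ}
    (hg : Continuous g) : ∫ z, g (diagMap s z) = (∏ k, s k)⁻¹ * ∫ z, g z := by
  have hprod : 0 < ∏ k, s k := Finset.prod_pos fun k _ => hs k
  have hdet : LinearMap.det (diagMap s) ≠ 0 := by
    rw [det_diagMap]; exact hprod.ne'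
  rw [← integral_map (φ := diagMap s) (continuous_diagMap s).aemeasurable
    hg.aestronglyMeasurable, Measure.map_linearMap_addHaar_eq_smul_addHaar _ hdet, det_diagMap,
    integral_smul_measure, ENNReal.toReal_ofReal (abs_nonneg _),
    abs_of_pos (inv_pos.2 hprod), smul_eq_mul]

lemma hasCompactSupport_comp_diagMap {s : Fin n ⊕ Fin m → ℝ} (hs : ∀ k, 0 < s k)
    {f : Space n m → ℝ} (hf : HasCompactSupport f) :
    HasCompactSupport fun z => f (diagMap s z) := by
  have hdet : LinearMap.det (diagMap s) ≠ 0 := by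
    rw [det_diagMap]; exact (Finset.prod_pos fun k _ => hs k).ne'
  exact hf.comp_homeomorph
    ((diagMap s).equivOfDetNeZero hdet).toContinuousLinearEquiv.toHomeomorph

lemma euclGrad_comp_diagMap {f : Space n m → ℝ} (hf : ContDiff ℝ 1 f) (s : Fin n ⊕ Fin m → ℝ)
    (z : Space n m) (k : Fin n ⊕ Fin m) :
    euclGrad (fun z => f (diagMap s z)) z k = s k * euclGrad f (diagMap s z) k := by
  have hL : HasFDerivAt (diagMap s) (LinearMap.toContinuousLinearMap (diagMap s)) z :=
    (LinearMap.toContinuousLinearMap (diagMap s)).hasFDerivAt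
  have h := ((hf.differentiable one_ne_zero _).hasFDerivAt.comp z hL).fderiv
  unfold euclGrad
  change fderiv ℝ (f ∘ diagMap s) z _ = _
  rw [h]
  simp [diagMap_single]

/-- The exponents of the anisotropic dilations that multiply the Grušin form by `t`. -/
def dilExponent (n : ℕ) {m : ℕ} (α : ℝ) (β : Fin m → ℝ) : Fin n ⊕ Fin m → ℝ :=
  Sum.elim (fun _ => 1 / (2 - α)) (fun j => (β j + (2 - α)) / (2 * (2 - α)))

/-- Identifies the Jacobian of the dilation as t^(D/2), which is how D enters. -/
lemma sum_dilExponent (hα2 : α < 2) :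
    ∑ k, dilExponent n α β k = homDim n m α β / 2 := by
  have h1 : 2 - α ≠ 0 := by linarith
  have h2 : 1 - α / 2 ≠ 0 := by intro h; apply h1; linarith
  simp only [dilExponent, homDim, Fintype.sum_sum_type, Sum.elim_inl, Sum.elim_inr,
    ← Finset.sum_div, Finset.sum_add_distrib, Finset.sum_const, Finset.card_univ,
    Fintype.card_fin, nsmul_eq_mul]
  have h3 : 1 - α / 2 = (2 - α) / 2 := by ring
  rw [h3]
  field_simp
  ring

lemma firstNorm_diagMap {s : Fin n ⊕ Fin m → ℝ} {l : ℝ} (hl : 0 ≤ l)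
    (hs : ∀ i, s (Sum.inl i) = l) (z : Space n m) :
    firstNorm (diagMap s z) = l * firstNorm z := by
  unfold firstNorm
  simp only [diagMap_apply, hs, mul_pow, ← Finset.mul_sum]
  rw [Real.sqrt_mul (sq_nonneg l), Real.sqrt_sq hl]

lemma weight_mul_sq_dil (hα2 : α < 2) {t : ℝ} (ht : 0 < t) (z : Space n m)
    (k : Fin n ⊕ Fin m) :
    weight α β z k * (t ^ dilExponent n α β k) ^ 2
      = t * weight α β (diagMap (fun k => t ^ dilExponent n α β k) z) k := by
  have h1 : 2 - α ≠ 0 := by linarith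
  have hl : 0 ≤ t ^ (1 / (2 - α)) := Real.rpow_nonneg ht.le _
  -- A coordinate with weight |x|^γ scales correctly exactly when its exponent e satisfies this
  -- relation; for γ = α it gives e = 1/(2 - α).
  have key : ∀ γ e : ℝ, 2 * e = 1 + 1 / (2 - α) * γ →
      firstNorm z ^ γ * (t ^ e) ^ 2 = t * (t ^ (1 / (2 - α)) * firstNorm z) ^ γ := by
    intro γ e h
    rw [Real.mul_rpow hl (firstNorm_nonneg z), ← Real.rpow_mul ht.le, ← Real.rpow_mul_natCast ht.le]
    push_cast
    rw [mul_comm e, h, Real.rpow_add ht, Real.rpow_one]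
    ring
  have hr : firstNorm (diagMap (fun k => t ^ dilExponent n α β k) z)
      = t ^ (1 / (2 - α)) * firstNorm z := firstNorm_diagMap hl (fun _ => rfl) z
  cases k with
  | inl i =>
    simp only [weight, Sum.elim_inl, hr]
    refine key _ _ ?_
    simp only [dilExponent, Sum.elim_inl]
    field_simp
    ring
  | inr j =>
    simp only [weight, Sum.elim_inr, hr]
    refine key _ _ ?_
    simp only [dilExponent, Sum.elim_inr]
    field_simp
    ring

lemma energyDensity_comp_dil (hα2 : α < 2) {t : ℝ} (ht : 0 < t) {f : Space n m → ℝ}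
    (hf : ContDiff ℝ 1 f) (z : Space n m) :
    energyDensity α β (fun z => f (diagMap (fun k => t ^ dilExponent n α β k) z)) z
      = t * energyDensity α β f (diagMap (fun k => t ^ dilExponent n α β k) z) := by
  rw [energyDensity_real, energyDensity_real, Finset.mul_sum]
  refine Finset.sum_congr rfl fun k _ => ?_
  rw [euclGrad_comp_diagMap hf, mul_pow, ← mul_assoc, weight_mul_sq_dil hα2 ht, mul_assoc]

end Dilation

lemma continuous_energyDensity {𝕜 : Type*} [RCLike 𝕜] (hα : 0 ≤ α) (hβ : ∀ j, 0 ≤ β j)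
    {f : Space n m → 𝕜} (hf : ContDiff ℝ 1 f) : Continuous (energyDensity α β f) :=
  continuous_finsetSum _ fun k _ =>
    (continuous_weight hα hβ k).mul ((continuous_euclGrad hf k).norm.pow 2)

/-- Apply the unit-scale bound to the dilated function. With P = t^(D/2) it reads P⁻¹F ≤ C(tP⁻¹E +
P⁻²N²); multiply by P. -/
lemma exists_scale_bound_real (hα : 0 ≤ α) (hα2 : α < 2) (hβ : ∀ j, 0 ≤ β j)
    (hn : n = 0 → ∀ j, β j = 0) :
    ∃ C : ℝ, 0 ≤ C ∧ ∀ f : Space n m → ℝ, ContDiff ℝ 1 f → HasCompactSupport f →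
      ∀ t : ℝ, 0 < t → ∫ z, f z ^ 2 ≤ C * (t * (∫ z, energyDensity α β f z)
        + t ^ (-(homDim n m α β / 2)) * (∫ z, |f z|) ^ 2) := by
  obtain ⟨C, hC, h⟩ := exists_unit_scale_bound (n := n) hα hα2 hβ hn
  refine ⟨C, hC, fun f hf hs t ht => ?_⟩
  set s : Fin n ⊕ Fin m → ℝ := fun k => t ^ dilExponent n α β k with hsdef
  have hspos : ∀ k, 0 < s k := fun k => Real.rpow_pos_of_pos ht _
  have hL : ContDiff ℝ 1 (diagMap s) :=
    (LinearMap.toContinuousLinearMap (diagMap s)).contDiff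
  have h1 := h (fun z => f (diagMap s z)) (hf.comp hL) (hasCompactSupport_comp_diagMap hspos hs)
  have e1 := integral_comp_diagMap hspos (hf.continuous.pow 2)
  have e2 := integral_comp_diagMap hspos hf.continuous.abs
  have e3 := integral_comp_diagMap hspos (continuous_energyDensity (α := α) hα hβ hf)
  simp only [Pi.pow_apply] at e1
  have hP : ∏ k, s k = t ^ (homDim n m α β / 2) := by
    rw [← sum_dilExponent hα2, Real.rpow_sum_of_pos ht]
  simp only [energyDensity_comp_dil hα2 ht hf, integral_const_mul, s] at h1
  rw [e1, e2, e3] at h1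
  rw [Real.rpow_neg ht.le, ← hP]
  have hPpos : 0 < ∏ k, s k := Finset.prod_pos fun k _ => hspos k
  have h2 := mul_le_mul_of_nonneg_left h1 hPpos.le
  rw [← mul_assoc, mul_inv_cancel₀ hPpos.ne', one_mul] at h2
  refine h2.trans_eq ?_
  field_simp

/-! ### Complex scalars and optimisation of the scale -/

section Complex

variable {𝕜 : Type*} [RCLike 𝕜]

lemma exists_scale_bound (hα : 0 ≤ α) (hα2 : α < 2) (hβ : ∀ j, 0 ≤ β j)
    (hn : n = 0 → ∀ j, β j = 0) :
    ∃ C : ℝ, 0 ≤ C ∧ ∀ f : Space n m → 𝕜, ContDiff ℝ 1 f → HasCompactSupport f →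
      ∀ t : ℝ, 0 < t → ∫ z, ‖f z‖ ^ 2 ≤ C * (t * (∫ z, energyDensity α β f z)
        + t ^ (-(homDim n m α β / 2)) * (∫ z, ‖f z‖) ^ 2) := by
  obtain ⟨C, hC, h⟩ := exists_scale_bound_real (n := n) hα hα2 hβ hn
  -- F and E split exactly into real and imaginary parts, but each part's L¹ norm is only bounded by
  -- that of f, hence the factor 2.
  refine ⟨2 * C, by positivity, fun f hf hs t ht => ?_⟩
  have hre : ContDiff ℝ 1 fun z => RCLike.re (f z) := (RCLike.reCLM (K := 𝕜)).contDiff.comp hf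
  have him : ContDiff ℝ 1 fun z => RCLike.im (f z) := (RCLike.imCLM (K := 𝕜)).contDiff.comp hf
  have sre : HasCompactSupport fun z => RCLike.re (f z) :=
    hs.comp_left (g := fun w : 𝕜 => RCLike.re w) (by simp)
  have sim : HasCompactSupport fun z => RCLike.im (f z) :=
    hs.comp_left (g := fun w : 𝕜 => RCLike.im w) (by simp)
  have gre : ∀ z k, euclGrad (fun z => RCLike.re (f z)) z k = RCLike.re (euclGrad f z k) := by
    intro z k
    have := ((RCLike.reCLM (K := 𝕜)).hasFDerivAt.comp z
      (hf.differentiable one_ne_zero z).hasFDerivAt).fderiv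
    unfold euclGrad
    change fderiv ℝ (RCLike.reCLM ∘ f) z _ = _
    rw [this]
    simp
  have gim : ∀ z k, euclGrad (fun z => RCLike.im (f z)) z k = RCLike.im (euclGrad f z k) := by
    intro z k
    have := ((RCLike.imCLM (K := 𝕜)).hasFDerivAt.comp z
      (hf.differentiable one_ne_zero z).hasFDerivAt).fderiv
    unfold euclGrad
    change fderiv ℝ (RCLike.imCLM ∘ f) z _ = _
    rw [this]
    simp
  have hnsq : ∀ w : 𝕜, ‖w‖ ^ 2 = RCLike.re w ^ 2 + RCLike.im w ^ 2 := fun w => by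
    rw [RCLike.norm_sq_eq_def]; ring
  have hF : ∫ z, ‖f z‖ ^ 2 = (∫ z, RCLike.re (f z) ^ 2) + ∫ z, RCLike.im (f z) ^ 2 := by
    rw [← integral_add (integrable_of_contDiff_of_hasCompactSupport hre sre).1
      (integrable_of_contDiff_of_hasCompactSupport him sim).1]
    simp only [hnsq]
  have hE : ∫ z, energyDensity α β f z = (∫ z, energyDensity α β (fun z => RCLike.re (f z)) z)
      + ∫ z, energyDensity α β (fun z => RCLike.im (f z)) z := by
    rw [← integral_add (integrable_energyDensity hα hβ hre sre)
      (integrable_energyDensity hα hβ him sim)]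
    refine integral_congr_ae (Filter.Eventually.of_forall fun z => ?_)
    simp only [gre, gim, energyDensity, hnsq (euclGrad f z _), mul_add, Real.norm_eq_abs, sq_abs,
      Finset.sum_add_distrib]
  have hfi : Integrable fun z => ‖f z‖ := (hf.continuous.integrable_of_hasCompactSupport hs).norm
  have n1 : ∫ z, |RCLike.re (f z)| ≤ ∫ z, ‖f z‖ :=
    integral_mono_of_nonneg (Filter.Eventually.of_forall fun z => abs_nonneg _) hfi
      (Filter.Eventually.of_forall fun z => RCLike.abs_re_le_norm _)
  have n2 : ∫ z, |RCLike.im (f z)| ≤ ∫ z, ‖f z‖ :=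
    integral_mono_of_nonneg (Filter.Eventually.of_forall fun z => abs_nonneg _) hfi
      (Filter.Eventually.of_forall fun z => RCLike.abs_im_le_norm _)
  have n1' := pow_le_pow_left₀ (integral_nonneg fun z => abs_nonneg _) n1 2
  have n2' := pow_le_pow_left₀ (integral_nonneg fun z => abs_nonneg _) n2 2
  have h1 := h _ hre sre t ht
  have h2 := h _ him sim t ht
  have hE1 : 0 ≤ ∫ z, energyDensity α β f z :=
    integral_nonneg fun z => energyDensity_nonneg f z
  rw [hE] at hE1 ⊢
  rw [hF]
  have hT : 0 ≤ t ^ (-(homDim n m α β / 2)) := Real.rpow_nonneg ht.le _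
  have m1 := mul_le_mul_of_nonneg_left n1' (mul_nonneg hC hT)
  have m2 := mul_le_mul_of_nonneg_left n2' (mul_nonneg hC hT)
  have m3 := mul_nonneg (mul_nonneg hC ht.le) hE1
  linarith

/-- Optimising over the scale. -/
lemma le_rpow_mul_rpow_of_forall_scale {F E a C D : ℝ} (hE : 0 ≤ E) (ha : 0 ≤ a) (hC : 0 ≤ C)
    (hD : 0 ≤ D) (h : ∀ t : ℝ, 0 < t → F ≤ C * (t * E + t ^ (-(D / 2)) * a)) :
    F ≤ 2 * C * E ^ (D / (D + 2)) * a ^ (1 - D / (D + 2)) := by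
  have hD2 : D + 2 ≠ 0 := by positivity
  have hp : 0 ≤ D / (D + 2) := by positivity
  have hq : 0 ≤ 1 - D / (D + 2) := by
    rw [sub_nonneg, div_le_one (by positivity)]
    linarith
  -- Shifting by η covers E = 0 or a = 0, where the balancing t below would be 0 or undefined; η
  -- tends to 0 at the end.
  have key : ∀ η : ℝ, 0 < η →
      F ≤ 2 * C * (E + η) ^ (D / (D + 2)) * (a + η) ^ (1 - D / (D + 2)) := by
    intro η hη
    have hx : 0 < E + η := by positivity
    have hy : 0 < a + η := by positivity
    set x := E + η
    set y := a + η
    set p := D / (D + 2) with hpdef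
    -- This t makes t x and t^(-D/2) y both equal to x^p y^(1-p), because (1 - p) D/2 = p.
    have ht : 0 < (y / x) ^ (1 - p) := Real.rpow_pos_of_pos (by positivity) _
    have h1 := h _ ht
    have e1 : (y / x) ^ (1 - p) * x = x ^ p * y ^ (1 - p) := by
      have : x ^ p * x ^ (1 - p) = x := by
        rw [← Real.rpow_add hx]; simp
      rw [Real.div_rpow hy.le hx.le, div_mul_eq_mul_div, div_eq_iff (by positivity)]
      nth_rewrite 1 [← this]
      ring
    have e2 : ((y / x) ^ (1 - p)) ^ (-(D / 2)) * y = x ^ p * y ^ (1 - p) := by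
      have hexp : (1 - p) * -(D / 2) = -p := by
        rw [hpdef]; field_simp; ring
      have : y ^ p * y ^ (1 - p) = y := by
        rw [← Real.rpow_add hy]; simp
      rw [← Real.rpow_mul (by positivity), hexp, Real.rpow_neg (by positivity),
        Real.div_rpow hy.le hx.le, inv_div, div_mul_eq_mul_div, div_eq_iff (by positivity)]
      nth_rewrite 1 [← this]
      ring
    have m1 : (y / x) ^ (1 - p) * E ≤ (y / x) ^ (1 - p) * x :=
      mul_le_mul_of_nonneg_left (by simp only [x]; linarith) ht.le
    have m2 : ((y / x) ^ (1 - p)) ^ (-(D / 2)) * a ≤ ((y / x) ^ (1 - p)) ^ (-(D / 2)) * y :=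
      mul_le_mul_of_nonneg_left (by simp only [y]; linarith) (Real.rpow_nonneg ht.le _)
    rw [e1] at m1
    rw [e2] at m2
    have := mul_le_mul_of_nonneg_left (add_le_add m1 m2) hC
    linarith
  have hlim : Filter.Tendsto
      (fun η : ℝ => 2 * C * (E + η) ^ (D / (D + 2)) * (a + η) ^ (1 - D / (D + 2)))
      (nhdsWithin 0 (Set.Ioi 0)) (nhds (2 * C * E ^ (D / (D + 2)) * a ^ (1 - D / (D + 2)))) := by
    have hc : Continuous
        fun η : ℝ => 2 * C * (E + η) ^ (D / (D + 2)) * (a + η) ^ (1 - D / (D + 2)) := by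
      refine (continuous_const.mul ?_).mul ?_
      · exact (by fun_prop : Continuous fun η : ℝ => E + η).rpow_const fun _ => Or.inr hp
      · exact (by fun_prop : Continuous fun η : ℝ => a + η).rpow_const fun _ => Or.inr hq
    simpa using (hc.tendsto 0).mono_left nhdsWithin_le_nhds
  exact ge_of_tendsto hlim (by filter_upwards [self_mem_nhdsWithin] with η hη using key η hη)

lemma gradLength_eq_sqrt (f : Space n m → 𝕜) (z : Space n m) :
    gradLength (grushinMatrix α β) f z = √(energyDensity α β f z) := by
  have hA : grushinMatrix α β z = Matrix.diagonal (weight α β z) := by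
    unfold grushinMatrix weight
    rw [← Matrix.fromBlocks_diagonal, Matrix.smul_one_eq_diagonal]
  unfold gradLength
  congr 1
  rw [matGrad, hA, Matrix.diagonal_map (map_zero _), dotProduct, map_sum, energyDensity]
  refine Finset.sum_congr rfl fun k _ => ?_
  rw [Matrix.mulVec_diagonal, Pi.star_apply, RCLike.star_def, mul_left_comm, RCLike.conj_mul]
  simp only [RCLike.algebraMap_eq_ofReal]
  norm_cast

end Complex

lemma homDim_nonneg (hα2 : α < 2) (hβ : ∀ j, 0 ≤ β j) : 0 ≤ homDim n m α β := by
  have h1 : 0 ≤ 1 - α / 2 := by linarith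
  have h2 : 0 ≤ ∑ k, β k := Finset.sum_nonneg fun k _ => hβ k
  unfold homDim
  positivity

end Grushin

/-! ### Translation to `eLpNorm` -/

open Grushin in
theorem mainTheorem1 {𝕜 : Type*} [RCLike 𝕜] (n m : ℕ) (hd : 1 ≤ n + m)
    (α : ℝ) (hα : 0 ≤ α) (hα2 : α < 2)
    (β : Fin m → ℝ) (hβ : ∀ j, 0 ≤ β j)
    (hn : n = 0 → ∀ j, β j = 0) :
    ∃ C : ℝ≥0, 0 < C ∧
      ∀ f : Grushin.Space n m → 𝕜, ContDiff ℝ 1 f → HasCompactSupport f →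
        eLpNorm f 2 volume ≤
          (C : ℝ≥0∞)
            * eLpNorm (Grushin.gradLength (Grushin.grushinMatrix α β) f) 2 volume
                ^ (Grushin.homDim n m α β / (Grushin.homDim n m α β + 2))
            * eLpNorm f 1 volume
                ^ (1 - Grushin.homDim n m α β / (Grushin.homDim n m α β + 2)) := by
  obtain ⟨C, hC, h⟩ := exists_scale_bound (𝕜 := 𝕜) (n := n) hα hα2 hβ hn
  have hD := homDim_nonneg (n := n) hα2 hβ
  set D := homDim n m α β
  have hp : 0 ≤ D / (D + 2) := by positivity
  have hq : 0 ≤ 1 - D / (D + 2) := by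
    rw [sub_nonneg, div_le_one (by positivity)]
    linarith
  -- The root undoes the squares in the integral inequality; the +1 keeps the constant positive even
  -- if C = 0.
  refine ⟨(√(2 * C + 1)).toNNReal, Real.toNNReal_pos.2 (by positivity),
    fun f hf hs => ?_⟩
  have hEnn : ∀ z, 0 ≤ energyDensity α β f z := fun z => energyDensity_nonneg f z
  have hE : 0 ≤ ∫ z, energyDensity α β f z := integral_nonneg hEnn
  have hN : 0 ≤ ∫ z, ‖f z‖ := integral_nonneg fun z => norm_nonneg _
  have hmain := le_rpow_mul_rpow_of_forall_scale hE (sq_nonneg _) hC hD (h f hf hs)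
  have hgrad : gradLength (grushinMatrix α β) f = fun z => √(energyDensity α β f z) :=
    funext fun z => gradLength_eq_sqrt f z
  have hgc : Continuous fun z => √(energyDensity α β f z) :=
    (continuous_energyDensity hα hβ hf).sqrt
  have hgL : MemLp (fun z => √(energyDensity α β f z)) 2 (volume : Measure (Space n m)) := by
    rw [memLp_two_iff_integrable_sq hgc.aestronglyMeasurable]
    simpa only [Real.sq_sqrt (hEnn _)] using integrable_energyDensity hα hβ hf hs
  have hfL (p : ℝ≥0∞) : MemLp f p (volume : Measure (Space n m)) :=
    hf.continuous.memLp_of_hasCompactSupport hs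
  rw [hgrad, hgL.eLpNorm_eq_integral_rpow_norm two_ne_zero ENNReal.ofNat_ne_top,
    (hfL 2).eLpNorm_eq_integral_rpow_norm two_ne_zero ENNReal.ofNat_ne_top,
    (hfL 1).eLpNorm_eq_integral_rpow_norm one_ne_zero ENNReal.one_ne_top]
  simp only [ENNReal.toReal_ofNat, ENNReal.toReal_one, Real.rpow_two, Real.rpow_one, inv_one,
    Real.norm_of_nonneg (Real.sqrt_nonneg _), Real.sq_sqrt (hEnn _)]
  change _ ≤ ENNReal.ofReal (√(2 * C + 1)) * _ * _
  rw [ENNReal.ofReal_rpow_of_nonneg (by positivity) hp,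
    ENNReal.ofReal_rpow_of_nonneg hN hq, ← ENNReal.ofReal_mul (by positivity),
    ← ENNReal.ofReal_mul (by positivity)]
  refine ENNReal.ofReal_le_ofReal ?_
  rw [Real.sqrt_eq_rpow]
  have hR : (2 * C + 1) ^ (1 / 2 : ℝ) * ((∫ z, energyDensity α β f z) ^ (2⁻¹ : ℝ)) ^ (D / (D + 2))
      * (∫ z, ‖f z‖) ^ (1 - D / (D + 2))
      = ((2 * C + 1) * (∫ z, energyDensity α β f z) ^ (D / (D + 2))
        * ((∫ z, ‖f z‖) ^ 2) ^ (1 - D / (D + 2))) ^ (2⁻¹ : ℝ) := by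
    rw [Real.mul_rpow (by positivity) (by positivity), Real.mul_rpow (by positivity)
      (by positivity), one_div]
    congr 1
    · congr 1
      rw [← Real.rpow_mul hE, ← Real.rpow_mul hE, mul_comm]
    · rw [← Real.rpow_natCast, ← Real.rpow_mul hN, ← Real.rpow_mul hN]
      congr 1
      push_cast
      ring
  rw [hR]
  refine Real.rpow_le_rpow (integral_nonneg fun z => sq_nonneg _) (hmain.trans ?_) (by norm_num)
  gcongr
  linarith

end
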